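/- Throughout, $\mathbb{N}=\{1,2,\dots\}$, $\omega\subseteq\mathbb{R}^d$ is open, and $\hat u(\xi)=\int_{\mathbb{R}^d}e^{-ix\cdot\xi}u(x)\,dx$. $\mathcal{G}(\omega)$ is the quotient of the space of moderate nets $(f_\varepsilon)_{\varepsilon\in(0,1)}$ in $C^\infty(\omega)$ (for all compact $K\subset\omega$ and all $k$ there is $a\in\mathbb{R}$ such that all derivatives of order $k$ satisfy $\sup_K|f_\varepsilon^{(\alpha)}|=O(\varepsilon^{a})$ as $\varepsilon\to0$) by the null nets (the same with $O(\varepsilon^{b})$ for every $b\in\mathbb{R}$). For $V\subseteq\omega$ open, $f\mapsto f|_V$ denotes the restriction $\mathcal{G}(\omega)\to\mathcal{G}(V)$. A *cut-off sequence at $x_0$ in $\omega$* is a sequence $(\kappa_n)_{n\in\mathbb{N}}$ in $\mathcal{D}(U)$, where $x_0\in W\Subset U\Subset\omega$ with $W,U$ open, such that $\kappa_n=1$ on $W$ for all $n$, and for every multi-index $\alpha$ there is $C_\alpha>0$ with $|\kappa_n^{(\alpha+\beta)}(x)|\le C_\alpha(C_\alpha n)^{|\beta|}$ for all $x$, all $n\in\mathbb{N}$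 and all $|\beta|\le n$. Let $x_0\in\omega$ and $\xi_0\in\mathbb{R}^d\setminus\{0\}$. A generalized function $f\in\mathcal{G}(\omega)$ is *g-microanalytic at $(x_0,\xi_0)$* if there are a representative $(f_\varepsilon)_\varepsilon$ of $f$, a cut-off sequence $(\kappa_n)_n$ at $x_0$ in $\omega$, an open cone $\Gamma\ni\xi_0$, and $a>0$, $C>0$, $\varepsilon_0\in(0,1)$ such that $$|\widehat{\kappa_nf_\varepsilon}(\xi)|\le C\varepsilon^{-a}\Big(\frac{Cn}{1+|\xi|}\Big)^n,\qquad n\in\mathbb{N},\ \xi\in\Gamma,\ \varepsilon\in(0,\varepsilon_0).$$ If $V$ is open and $x_0\in V$, a distribution $T\in\mathcal{D}'(V)$ is *microanalytic at $(x_0,\xi_0)$* if there are a cut-off sequence $(\kappa_n)_n$ at $x_0$ in $V$, an open cone $\Gamma\ni\xi_0$ and $C>0$ such that $|\widehat{\kappa_nT}(\xi)|\le C\big(\frac{Cn}{1+|\xi|}\big)^n$ for all $n\in\mathbb{N}$, $\xi\in\Gamma$, where $\widehat{\kappa_nT}(\xi)=\langle T,\kappa_ne^{-i\langle\cdot,\xi\rangle}\rangle$.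 A distribution $T\in\mathcal{D}'(V)$ and $g=[(g_\varepsilon)_\varepsilon]\in\mathcal{G}(V)$ are *strongly associated* if for every compact $K\subset V$ there is $a>0$ such that for every $\theta\in\mathcal{D}(V)$ with $\operatorname{supp}\theta\subset K$ one has $|\langle T-g_\varepsilon,\theta\rangle|=O(\varepsilon^a)$ as $\varepsilon\to0$ (this does not depend on the representative). **Theorem.** Let $f\in\mathcal{G}(\omega)$ be g-microanalytic at $(x_0,\xi_0)\in\omega\times(\mathbb{R}^d\setminus\{0\})$, let $V\subseteq\omega$ be an open neighborhood of $x_0$, and let $T\in\mathcal{D}'(V)$ be strongly associated to $f|_V$. Then $T$ is microanalytic at $(x_0,\xi_0)$. -/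

import Mathlib

namespace Colombeau

open Set Filter Topology MeasureTheory TopologicalSpace
open scoped ContDiff Distributions

/-- The Euclidean space `ℝ^d`. -/
abbrev Rd (d : ℕ) : Type := EuclideanSpace ℝ (Fin d)

/-- Nets of smooth functions on `Ω` (indexed by `ε ∈ (0,1)`) all of whose derivatives are, on
compact subsets of `Ω`, bounded by `O(ε^a)` for some `a`. A net is written as a function of
`ε : ℝ` and `x : ℝ^d`; its values for `ε ∉ (0,1)` or `x ∉ Ω` are irrelevant and are
identified by the quotient below. -/
def moderate {d : ℕ} (Ω : Opens (Rd d)) : Submodule ℂ (ℝ → Rd d → ℂ) where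
  carrier := {f | (∀ ε ∈ Ioo (0 : ℝ) 1, ContDiffOn ℝ ∞ (f ε) Ω) ∧
    ∀ K : Set (Rd d), IsCompact K → K ⊆ Ω → ∀ k : ℕ, ∃ a C : ℝ,
      ∀ᶠ ε in 𝓝[>] (0 : ℝ), ∀ x ∈ K, ‖iteratedFDeriv ℝ k (f ε) x‖ ≤ C * ε ^ a}
  zero_mem' := by
    refine ⟨fun ε _ => contDiffOn_const, fun K _ _ k => ⟨0, 0, Eventually.of_forall ?_⟩⟩
    intro ε x _
    change ‖iteratedFDeriv ℝ k (fun _ : Rd d => (0 : ℂ)) x‖ ≤ _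
    simp
  add_mem' := by
    rintro f g ⟨hf, hf'⟩ ⟨hg, hg'⟩
    refine ⟨fun ε hε => (hf ε hε).add (hg ε hε), fun K hK hKO k => ?_⟩
    obtain ⟨a, C, h₁⟩ := hf' K hK hKO k
    obtain ⟨b, D, h₂⟩ := hg' K hK hKO k
    refine ⟨min a b, |C| + |D|, ?_⟩
    filter_upwards [h₁, h₂, Ioo_mem_nhdsGT (zero_lt_one' ℝ)] with ε h₁ h₂ hε x hx
    have hn := Ω.isOpen.mem_nhds (hKO hx)
    have e : iteratedFDeriv ℝ k ((f + g) ε) x =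
        iteratedFDeriv ℝ k (f ε) x + iteratedFDeriv ℝ k (g ε) x :=
      iteratedFDeriv_add_apply
        (((hf ε hε).contDiffAt hn).of_le (by exact_mod_cast le_top))
        (((hg ε hε).contDiffAt hn).of_le (by exact_mod_cast le_top))
    have p₁ : ε ^ a ≤ ε ^ min a b :=
      Real.rpow_le_rpow_of_exponent_ge hε.1 hε.2.le (min_le_left _ _)
    have p₂ : ε ^ b ≤ ε ^ min a b :=
      Real.rpow_le_rpow_of_exponent_ge hε.1 hε.2.le (min_le_right _ _)
    have q₁ : C * ε ^ a ≤ |C| * ε ^ min a b :=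
      mul_le_mul (le_abs_self C) p₁ (Real.rpow_nonneg hε.1.le _) (abs_nonneg _)
    have q₂ : D * ε ^ b ≤ |D| * ε ^ min a b :=
      mul_le_mul (le_abs_self D) p₂ (Real.rpow_nonneg hε.1.le _) (abs_nonneg _)
    rw [e]
    calc _ ≤ _ := norm_add_le _ _
      _ ≤ _ := add_le_add ((h₁ x hx).trans q₁) ((h₂ x hx).trans q₂)
      _ = _ := by ring
  smul_mem' := by
    rintro c f ⟨hf, hf'⟩
    refine ⟨fun ε hε => (hf ε hε).const_smul c, fun K hK hKO k => ?_⟩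
    obtain ⟨a, C, h₁⟩ := hf' K hK hKO k
    refine ⟨a, ‖c‖ * C, ?_⟩
    filter_upwards [h₁, Ioo_mem_nhdsGT (zero_lt_one' ℝ)] with ε h₁ hε x hx
    have hn := Ω.isOpen.mem_nhds (hKO hx)
    have e : iteratedFDeriv ℝ k ((c • f) ε) x = c • iteratedFDeriv ℝ k (f ε) x := by
      change iteratedFDeriv ℝ k (c • f ε) x = _
      exact iteratedFDeriv_const_smul_apply (a := c) (i := k)
        (((hf ε hε).contDiffAt hn).of_le (by exact_mod_cast le_top))
    rw [e, norm_smul, mul_assoc]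
    exact mul_le_mul_of_nonneg_left (h₁ x hx) (norm_nonneg c)

/-- Moderate nets all of whose derivatives are, on compact subsets of `Ω`, bounded by
`O(ε^b)` for every `b`. -/
def null {d : ℕ} (Ω : Opens (Rd d)) : Submodule ℂ (moderate Ω) where
  carrier := {f | ∀ K : Set (Rd d), IsCompact K → K ⊆ Ω → ∀ k : ℕ, ∀ b : ℝ, ∃ C : ℝ,
      ∀ᶠ ε in 𝓝[>] (0 : ℝ), ∀ x ∈ K, ‖iteratedFDeriv ℝ k (f.1 ε) x‖ ≤ C * ε ^ b}
  zero_mem' := by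
    refine fun K _ _ k b => ⟨0, Eventually.of_forall ?_⟩
    intro ε x _
    change ‖iteratedFDeriv ℝ k (fun _ : Rd d => (0 : ℂ)) x‖ ≤ _
    simp
  add_mem' := by
    rintro f g hf' hg' K hK hKO k b
    obtain ⟨C, h₁⟩ := hf' K hK hKO k b
    obtain ⟨D, h₂⟩ := hg' K hK hKO k b
    refine ⟨C + D, ?_⟩
    filter_upwards [h₁, h₂, Ioo_mem_nhdsGT (zero_lt_one' ℝ)] with ε h₁ h₂ hε x hx
    have hn := Ω.isOpen.mem_nhds (hKO hx)
    have e : iteratedFDeriv ℝ k ((f + g).1 ε) x =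
        iteratedFDeriv ℝ k (f.1 ε) x + iteratedFDeriv ℝ k (g.1 ε) x :=
      iteratedFDeriv_add_apply
        (((f.2.1 ε hε).contDiffAt hn).of_le (by exact_mod_cast le_top))
        (((g.2.1 ε hε).contDiffAt hn).of_le (by exact_mod_cast le_top))
    rw [e, add_mul]
    exact (norm_add_le _ _).trans (add_le_add (h₁ x hx) (h₂ x hx))
  smul_mem' := by
    rintro c f hf' K hK hKO k b
    obtain ⟨C, h₁⟩ := hf' K hK hKO k b
    refine ⟨‖c‖ * C, ?_⟩
    filter_upwards [h₁, Ioo_mem_nhdsGT (zero_lt_one' ℝ)] with ε h₁ hε x hx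
    have hn := Ω.isOpen.mem_nhds (hKO hx)
    have e : iteratedFDeriv ℝ k ((c • f).1 ε) x = c • iteratedFDeriv ℝ k (f.1 ε) x := by
      change iteratedFDeriv ℝ k (c • f.1 ε) x = _
      exact iteratedFDeriv_const_smul_apply (a := c) (i := k)
        (((f.2.1 ε hε).contDiffAt hn).of_le (by exact_mod_cast le_top))
    rw [e, norm_smul, mul_assoc]
    exact mul_le_mul_of_nonneg_left (h₁ x hx) (norm_nonneg c)

/-- The (simplified) Colombeau space `𝒢(Ω)` of generalized functions: moderate nets modulo
null nets. -/
abbrev GenFun {d : ℕ} (Ω : Opens (Rd d)) : Type := moderate Ω ⧸ null Ω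

/-- Restriction of moderate nets to a smaller open set. -/
def restrictNet {d : ℕ} {V Ω : Opens (Rd d)} (h : V ≤ Ω) : moderate Ω →ₗ[ℂ] moderate V :=
  Submodule.inclusion fun _ hf =>
    ⟨fun ε hε => (hf.1 ε hε).mono h, fun K hK hKV => hf.2 K hK (hKV.trans h)⟩

/-- Restriction `f ↦ f|_V` of generalized functions, `𝒢(Ω) → 𝒢(V)`, for `V ⊆ Ω`. -/
def restrict {d : ℕ} {V Ω : Opens (Rd d)} (h : V ≤ Ω) : GenFun Ω →ₗ[ℂ] GenFun V :=
  Submodule.mapQ (null Ω) (null V) (restrictNet h) fun _ hf K hK hKV =>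
    hf K hK (hKV.trans h)

/-- The space `𝒟'(V)` of complex distributions: continuous complex-linear functionals on the
space `𝒟(V)` of complex test functions with its usual topology. -/
abbrev Distr {d : ℕ} (V : Opens (Rd d)) : Type := 𝓓(V, ℂ) →L[ℂ] ℂ

/-- The exponential `x ↦ e^{-i x·ξ}`. -/
noncomputable def expChar {d : ℕ} (ξ x : Rd d) : ℂ :=
  Complex.exp (-Complex.I * (inner ℝ x ξ : ℝ))

theorem contDiff_expChar {d : ℕ} (ξ : Rd d) : ContDiff ℝ ∞ (expChar ξ) := by
  unfold expChar
  refine Complex.contDiff_exp.comp (contDiff_const.mul ?_)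
  exact Complex.ofRealCLM.contDiff.comp (contDiff_id.inner ℝ contDiff_const)

/-- The Fourier transform `ĝ(ξ) = ∫ e^{-i x·ξ} g(x) dx`. -/
noncomputable def fourierHat {d : ℕ} (g : Rd d → ℂ) (ξ : Rd d) : ℂ := ∫ x, expChar ξ x * g x

/-- The test function `x ↦ κ(x) e^{-i x·ξ}`. -/
noncomputable def modulate {d : ℕ} {V : Opens (Rd d)} (κ : 𝓓(V, ℂ)) (ξ : Rd d) : 𝓓(V, ℂ) where
  toFun := fun x => κ x * expChar ξ x
  contDiff' := κ.contDiff.mul (contDiff_expChar ξ)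
  hasCompactSupport' := κ.hasCompactSupport.mul_right
  tsupport_subset' := (tsupport_mul_subset_left (f := κ)).trans κ.tsupport_subset

/-- The Fourier transform of the compactly supported distribution `κ T`,
`(κT)^(ξ) = ⟨T, κ e^{-i⟨·,ξ⟩}⟩`. -/
noncomputable def distrFourier {d : ℕ} {V : Opens (Rd d)} (κ : 𝓓(V, ℂ)) (T : Distr V)
    (ξ : Rd d) : ℂ := T (modulate κ ξ)

/-- `κ` is a sequence of cut-off functions of analytic type at `x₀` in `Ω`: there are open sets
`x₀ ∈ W ⋐ U ⋐ Ω` with `κ_n ∈ 𝒟(U)`, `κ_n = 1` on `W`, and for every order `j` a constant `C`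
such that the derivatives satisfy `|κ_n^{(α+β)}| ≤ C (C n)^{|β|}` for `|α| = j`, `|β| ≤ n`. -/
def IsCutoffSeq {d : ℕ} (Ω : Opens (Rd d)) (x₀ : Rd d) (κ : ℕ → 𝓓(Ω, ℂ)) : Prop :=
  ∃ W U : Set (Rd d), IsOpen W ∧ IsOpen U ∧ x₀ ∈ W ∧
    IsCompact (closure W) ∧ closure W ⊆ U ∧ IsCompact (closure U) ∧ closure U ⊆ Ω ∧
    (∀ n, 1 ≤ n → tsupport (κ n) ⊆ U ∧ ∀ x ∈ W, κ n x = 1) ∧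
    ∀ j : ℕ, ∃ C : ℝ, 0 < C ∧ ∀ n, 1 ≤ n → ∀ m ≤ n, ∀ x,
      ‖iteratedFDeriv ℝ (j + m) (κ n) x‖ ≤ C * (C * n) ^ m

/-- `Γ` is an open conic neighborhood of `ξ₀`. -/
def IsConicNhd {d : ℕ} (ξ₀ : Rd d) (Γ : Set (Rd d)) : Prop :=
  IsOpen Γ ∧ ξ₀ ∈ Γ ∧ ∀ ξ ∈ Γ, ∀ t : ℝ, 0 < t → t • ξ ∈ Γ

/-- `f ∈ 𝒢(Ω)` is g-microanalytic at `(x₀, ξ₀)`: some representative `(f_ε)` satisfies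
`|(κ_n f_ε)^(ξ)| ≤ C ε^{-a} (C n / (1 + |ξ|))^n` for `n ∈ ℕ`, `ξ ∈ Γ`, `0 < ε < ε₀`. -/
def GMicroanalytic {d : ℕ} {Ω : Opens (Rd d)} (f : GenFun Ω) (x₀ ξ₀ : Rd d) : Prop :=
  ∃ F : moderate Ω, (null Ω).mkQ F = f ∧
    ∃ κ : ℕ → 𝓓(Ω, ℂ), IsCutoffSeq Ω x₀ κ ∧
    ∃ Γ : Set (Rd d), IsConicNhd ξ₀ Γ ∧
    ∃ a C ε₀ : ℝ, 0 < a ∧ 0 < C ∧ ε₀ ∈ Ioo (0 : ℝ) 1 ∧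
      ∀ n : ℕ, 1 ≤ n → ∀ ξ ∈ Γ, ∀ ε ∈ Ioo 0 ε₀,
        ‖fourierHat (fun x => κ n x * F.1 ε x) ξ‖ ≤ C * ε ^ (-a) * (C * n / (1 + ‖ξ‖)) ^ n

/-- `T ∈ 𝒟'(V)` is microanalytic at `(x₀, ξ₀)`:
`|(κ_n T)^(ξ)| ≤ C (C n / (1 + |ξ|))^n` for `n ∈ ℕ`, `ξ ∈ Γ`. -/
def Microanalytic {d : ℕ} {V : Opens (Rd d)} (T : Distr V) (x₀ ξ₀ : Rd d) : Prop :=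
  ∃ κ : ℕ → 𝓓(V, ℂ), IsCutoffSeq V x₀ κ ∧
    ∃ Γ : Set (Rd d), IsConicNhd ξ₀ Γ ∧
    ∃ C : ℝ, 0 < C ∧ ∀ n : ℕ, 1 ≤ n → ∀ ξ ∈ Γ,
      ‖distrFourier (κ n) T ξ‖ ≤ C * (C * n / (1 + ‖ξ‖)) ^ n

/-- `T ∈ 𝒟'(V)` and `g = [(g_ε)] ∈ 𝒢(V)` are strongly associated: for every compact `K ⊆ V`
there is `a > 0` with `⟨T - g_ε, θ⟩ = O(ε^a)` for all `θ ∈ 𝒟(V)` supported in `K`.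
(The condition does not depend on the representative.) -/
def StronglyAssociated {d : ℕ} {V : Opens (Rd d)} (T : Distr V) (g : GenFun V) : Prop :=
  ∃ G : moderate V, (null V).mkQ G = g ∧
    ∀ K : Set (Rd d), IsCompact K → K ⊆ V → ∃ a : ℝ, 0 < a ∧
      ∀ θ : 𝓓(V, ℂ), tsupport θ ⊆ K →
        (fun ε : ℝ => T θ - ∫ x, G.1 ε x * θ x) =O[𝓝[>] 0] fun ε : ℝ => ε ^ a

end Colombeau

/-! Write `X = 1 + ‖ξ‖`. The transform of `χₙ T` is compared with that of `χₙ f_ε`, and `ε` is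
chosen as a function of `n` and `ξ`.

The difference `T - f_ε` is small. Strong association is pointwise in the test function, but the
smooth functions supported in a fixed compact set form a Fréchet space. Banach-Steinhaus therefore
makes the `O(ε^b)` uniform with respect to a seminorm of some finite order `N`
(`exists_order_bound_of_isBigO`). On `χₙ e^{-i⟨·,ξ⟩}` that seminorm is at most a constant times `X ^
N`, since derivatives of fixed order of `χₙ` are bounded in `n`.

The transform of `χₙ f_ε` has analytic decay at the price of a factor `ε^{-a}`. The hypothesis gives
this for cut-offs `κₙ` that may leave `V`. Dilating them about `x₀` produces `χₙ` supported where
`κₙ = 1` and inside `V` (`IsCutoffSeq.exists_shrink`). Then `χₙ f_ε = χₙ (κₙ f_ε)`, and a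
convolution estimate carries the decay over to a smaller cone (`IsCutoffSeq.fourierHat_mul_le`).

Together these bound `(χₙ T)^(ξ)` by `C ε^b X^N + C ε^{-a} (C n / X)^n`. Taking `n = L k` and `ε`
comparable to `(k / X)^{k s}`, with `s b = 1 + N` and `L ≥ a s + 1`, makes both terms at most `C'
(C' k / X)^k` when `k ≤ X` (`exists_analytic_bound`). The cut-offs `χ_{Lk}` then witness
microanalyticity. -/

namespace Colombeau

open Set Filter Topology MeasureTheory TopologicalSpace
open scoped ContDiff Distributions

/-! ### Smooth functions supported in a fixed compact set form a Fréchet space. -/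

section Frechet

variable {E F : Type*} [NormedAddCommGroup E] [NormedSpace ℝ E] [NormedAddCommGroup F]
  [NormedSpace ℝ F] {K : Compacts E}

theorem isSeqClosed_range_structureMaps :
    IsSeqClosed (range (ContinuousLinearMap.pi
      (ContDiffMapSupportedIn.structureMapCLM ℝ ⊤ (E := E) (F := F) (K := K)))) := by
  intro v g hv hg
  choose u hu using hv
  have hunif : ∀ i, TendstoUniformly (fun n x => iteratedFDeriv ℝ i (u n) x) (g i) atTop := by
    intro i
    have h1 := (tendsto_pi_nhds.1 hg i)
    rw [BoundedContinuousFunction.tendsto_iff_tendstoUniformly] at h1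
    have h2 : (fun n x => iteratedFDeriv ℝ i (u n) x) = fun n => ⇑(v n i) := by
      funext n
      rw [← hu n, ContinuousLinearMap.pi_apply, ContDiffMapSupportedIn.structureMapCLM_top_apply]
    rw [h2]
    exact h1
  set f : E → F := fun x => g 0 x 0 with hf
  have hT : HasFTaylorSeriesUpTo ∞ f (fun x i => g i x) := by
    constructor
    · intro x; rfl
    · intro m _ x
      -- Each order of derivative converges uniformly, so differentiation passes to the limit and
      -- the `g i` form a Taylor series of `g 0`.
      have key := hasFDerivAt_of_tendstoUniformly (l := atTop) (𝕜 := ℝ)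
        (f := fun n x => iteratedFDeriv ℝ m (u n) x)
        (f' := fun n x => (iteratedFDeriv ℝ (m+1) (u n) x).curryLeft)
        (g := g m) (g' := fun x => (g (m+1) x).curryLeft) ?_ ?_ ?_ x
      · exact key
      · exact (continuousMultilinearCurryLeftEquiv ℝ (fun _ : Fin (m+1) => E)
          F).isometry.uniformContinuous.comp_tendstoUniformly (hunif (m+1))
      · intro n x
        have := ((u n).contDiff.ftaylorSeries (𝕜 := ℝ)).fderiv m
          (by exact_mod_cast ENat.natCast_lt_top m) x
        exact this
      · intro x
        exact (hunif m).tendsto_at x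
    · intro m _
      exact (g m).continuous
  have hfc : ContDiff ℝ ∞ f := hT.contDiff
  refine ⟨⟨f, hfc, ?_⟩, ?_⟩
  · intro x hx
    have h0 := (hunif 0).tendsto_at x
    have : ∀ n, iteratedFDeriv ℝ 0 (u n) x = 0 := fun n =>
      (u n).iteratedFDeriv_zero_on_compl hx
    simp only [this] at h0
    have h1 := tendsto_nhds_unique h0 tendsto_const_nhds
    simp [hf, h1]
  · ext i : 1
    apply BoundedContinuousFunction.ext
    intro x
    rw [ContinuousLinearMap.pi_apply, ContDiffMapSupportedIn.structureMapCLM_top_apply]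
    exact (hT.eq_iteratedFDeriv (by exact_mod_cast le_top) x).symm

/-- Together with the countably generated uniformity below, completeness makes the space Baire,
hence barrelled, as Banach-Steinhaus requires. -/
instance completeSpace_contDiffMapSupportedIn [CompleteSpace F] :
    CompleteSpace (ContDiffMapSupportedIn E F ⊤ K) := by
  have h := ContDiffMapSupportedIn.isUniformEmbedding_pi_structureMapCLM ℝ
    (E := E) (F := F) (n := ⊤) (K := K)
  rw [completeSpace_iff_isComplete_range h.isUniformInducing]
  exact isSeqClosed_range_structureMaps.isClosed.isComplete

instance isCountablyGenerated_uniformity_contDiffMapSupportedIn :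
    IsCountablyGenerated (uniformity (ContDiffMapSupportedIn E F ⊤ K)) := by
  have h := ContDiffMapSupportedIn.isUniformEmbedding_pi_structureMapCLM ℝ
    (E := E) (F := F) (n := ⊤) (K := K)
  rw [← h.isUniformInducing.comap_uniformity]
  infer_instance

end Frechet

/-! ### Uniform boundedness: from pointwise to finite-order estimates. -/

/-- A family of continuous functionals on a barrelled space which is pointwise `O(g)` at `0⁺`
is uniformly `O(g)` with respect to a continuous seminorm. -/
theorem exists_uniform_bound_of_isBigO {X : Type*} [AddCommGroup X] [Module ℂ X] [UniformSpace X]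
    [IsUniformAddGroup X] [ContinuousSMul ℂ X] [BarrelledSpace ℂ X] {p : ℕ → Seminorm ℂ X}
    (hp : WithSeminorms p) (hmono : Monotone p) (L : ℝ → X →L[ℂ] ℂ) {g : ℝ → ℝ}
    (hg : ∀ ε, 0 < ε → 0 < g ε) (h : ∀ x, (fun ε => L ε x) =O[𝓝[>] 0] g) :
    ∃ (N : ℕ) (C ε₁ : ℝ), 0 < C ∧ 0 < ε₁ ∧ ∀ ε ∈ Ioo 0 ε₁, ∀ x, ‖L ε x‖ ≤ C * g ε * p N x := by
  by_contra! hcon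
  -- The index `j` serves at once as seminorm index, as constant and as inverse bound on `ε`.
  -- Passing to a sequence turns a bound near `0⁺` that depends on the vector into pointwise
  -- boundedness of a countable family.
  choose e he x hx using fun j : ℕ => hcon j (j + 1) (1 / (j + 1)) (by positivity) (by positivity)
  have hlim : Tendsto e atTop (𝓝[>] 0) := by
    refine tendsto_nhdsWithin_iff.2 ⟨?_, Eventually.of_forall fun j => (he j).1⟩
    exact squeeze_zero (fun j => (he j).1.le) (fun j => (he j).2.le)
      tendsto_one_div_add_atTop_nhds_zero_nat
  have hgj : ∀ j, 0 < g (e j) := fun j => hg _ (he j).1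
  have hue := (norm_withSeminorms ℂ ℂ) |>.banach_steinhaus
    (𝓕 := fun j : ℕ => ((g (e j))⁻¹ : ℂ) • L (e j)) (by
      intro _ y
      obtain ⟨c, hc⟩ := ((h y).comp_tendsto hlim).bound
      refine Filter.IsBoundedUnder.bddAbove_range ⟨c, ?_⟩
      rw [eventually_map]
      filter_upwards [hc] with j hj
      simp only [Function.comp, Real.norm_eq_abs, abs_of_pos (hgj j)] at hj
      have : ‖L (e j) y‖ / g (e j) ≤ c := (div_le_iff₀ (hgj j)).2 hj
      simpa [abs_of_pos (hgj j), div_eq_inv_mul] using this)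
  obtain ⟨q, hq, hqb⟩ := ((norm_withSeminorms ℂ ℂ).uniformEquicontinuous_iff_exists_continuous_seminorm
    (fun j : ℕ => (((g (e j))⁻¹ : ℂ) • L (e j) : X →L[ℂ] ℂ).toLinearMap)).1 hue 0
  obtain ⟨s, C, -, hC⟩ := Seminorm.bound_of_continuous hp q hq
  set N := s.sup id
  have hsN : s.sup p ≤ p N := Finset.sup_le fun i hi => hmono (Finset.le_sup (f := id) hi)
  obtain ⟨j, hj⟩ := exists_nat_ge (max (C : ℝ) N)
  have hjC : (C : ℝ) ≤ j + 1 := by linarith [le_max_left (C : ℝ) N]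
  have hjN : N ≤ j := by exact_mod_cast (le_max_right (C : ℝ) N).trans hj
  have h1 : ‖L (e j) (x j)‖ / g (e j) ≤ q (x j) := by
    have := hqb j (x j)
    simpa [abs_of_pos (hgj j), div_eq_inv_mul] using this
  have h2 : q (x j) ≤ C * p j (x j) := by
    refine (hC (x j)).trans ?_
    exact mul_le_mul_of_nonneg_left ((hsN.trans (hmono hjN)) (x j)) C.2
  have h3 := (div_le_iff₀ (hgj j)).1 (h1.trans h2)
  have h4 : C * p j (x j) * g (e j) ≤ (j + 1) * g (e j) * p j (x j) := by
    have : (C : ℝ) * (p j (x j) * g (e j)) ≤ (j + 1) * (p j (x j) * g (e j)) :=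
      mul_le_mul_of_nonneg_right hjC (mul_nonneg (apply_nonneg _ _) (hgj j).le)
    linarith
  exact absurd (h3.trans h4) (not_le.2 (hx j))

/-- Neither `N` nor `C` depends on `ε` or `θ`, so `θ` may later vary with `n` and `ξ`. -/
theorem exists_order_bound_of_isBigO {d : ℕ} {V : Opens (Rd d)} (T : Distr V)
    (G : ℝ → Rd d → ℂ) (hG : ∀ ε ∈ Ioo (0 : ℝ) 1, ContinuousOn (G ε) V)
    (K : Compacts (Rd d)) (hK : (K : Set (Rd d)) ⊆ V) (b : ℝ)
    (h : ∀ θ : 𝓓(V, ℂ), tsupport θ ⊆ K →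
        (fun ε : ℝ => T θ - ∫ x, G ε x * θ x) =O[𝓝[>] 0] fun ε : ℝ => ε ^ b) :
    ∃ (N : ℕ) (C ε₁ : ℝ), 0 < C ∧ ε₁ ∈ Ioo (0 : ℝ) 1 ∧ ∀ ε ∈ Ioo 0 ε₁, ∀ θ : 𝓓(V, ℂ),
      tsupport θ ⊆ K → ∀ M, 0 ≤ M → (∀ i ≤ N, ∀ x, ‖iteratedFDeriv ℝ i θ x‖ ≤ M) →
      ‖T θ - ∫ x, G ε x * θ x‖ ≤ C * ε ^ b * M := by
  set B := ContinuousLinearMap.mul ℂ ℂ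
  set L : ℝ → ContDiffMapSupportedIn (Rd d) ℂ ⊤ K →L[ℂ] ℂ := fun ε =>
    T ∘L TestFunction.ofSupportedInCLM ℂ hK -
      ContDiffMapSupportedIn.integralAgainstBilinCLM B volume (G ε) with hL
  have hLval : ∀ ε ∈ Ioo (0 : ℝ) 1, ∀ θ : ContDiffMapSupportedIn (Rd d) ℂ ⊤ K,
      L ε θ = T (TestFunction.ofSupportedIn hK θ) - ∫ x, G ε x * θ x := by
    intro ε hε θ
    have hint : IntegrableOn (G ε) K volume :=
      ((hG ε hε).mono hK).integrableOn_compact K.isCompact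
    simp only [hL, sub_apply, ContinuousLinearMap.coe_comp, Function.comp,
      ContDiffMapSupportedIn.integralAgainstBilinCLM_eq_integral hint]
    congr 1
    refine integral_congr_ae (Eventually.of_forall fun x => ?_)
    simp [B, mul_comm]
  have hw := ContDiffMapSupportedIn.withSeminorms' ℂ (Rd d) ℂ ⊤ K
  have hmono : Monotone (ContDiffMapSupportedIn.supSeminorm ℂ (Rd d) ℂ ⊤ K) := fun i j hij =>
    Finset.sup_mono (Finset.Iic_subset_Iic.2 hij)
  obtain ⟨N, C, ε₁, hC, hε₁, hb⟩ := exists_uniform_bound_of_isBigO hw hmono L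
    (g := fun ε => ε ^ b) (fun ε hε => Real.rpow_pos_of_pos hε _) (by
      intro θ
      refine (h (TestFunction.ofSupportedIn hK θ) θ.tsupport_subset).congr' ?_ EventuallyEq.rfl
      filter_upwards [Ioo_mem_nhdsGT (zero_lt_one' ℝ)] with ε hε
      rw [hLval ε hε]
      rfl)
  refine ⟨N, C, min ε₁ (1 / 2), hC, ⟨by positivity, by
    exact (min_le_right _ _).trans_lt (by norm_num)⟩, ?_⟩
  intro ε hε θ hθ M hM hder
  have hε1 : ε ∈ Ioo (0 : ℝ) 1 :=
    ⟨hε.1, hε.2.trans ((min_le_right _ _).trans_lt (by norm_num))⟩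
  have hε2 : ε ∈ Ioo 0 ε₁ := ⟨hε.1, hε.2.trans_le (min_le_left _ _)⟩
  set θ' : ContDiffMapSupportedIn (Rd d) ℂ ⊤ K := ContDiffMapSupportedIn.of_support_subset
    θ.contDiff ((subset_tsupport θ).trans hθ)
  have h1 := hb ε hε2 θ'
  rw [hLval ε hε1] at h1
  refine h1.trans (mul_le_mul_of_nonneg_left ?_
    (mul_nonneg hC.le (Real.rpow_nonneg hε.1.le _)))
  refine Seminorm.finset_sup_apply_le hM fun i hi => ?_
  rw [ContDiffMapSupportedIn.seminorm_top_le_iff ℂ hM]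
  intro x _
  exact hder i (Finset.mem_Iic.1 hi) x

/-! ### Derivatives of modulated test functions. -/

theorem iteratedDeriv_cexp_neg_I_mul (k : ℕ) :
    iteratedDeriv k (fun t : ℝ => Complex.exp (-Complex.I * t)) =
      fun t : ℝ => (-Complex.I) ^ k * Complex.exp (-Complex.I * t) := by
  induction k with
  | zero => simp
  | succ k ih =>
    rw [iteratedDeriv_succ, ih]
    funext t
    have h1 : HasDerivAt (fun t : ℝ => -Complex.I * (t : ℂ)) (-Complex.I) t := by
      simpa using (Complex.ofRealCLM.hasDerivAt (x := t)).const_mul (-Complex.I)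
    rw [(h1.cexp.const_mul _).deriv]
    ring

theorem norm_iteratedFDeriv_expChar_le {d : ℕ} (ξ x : Rd d) (k : ℕ) :
    ‖iteratedFDeriv ℝ k (expChar ξ) x‖ ≤ ‖ξ‖ ^ k := by
  have hsm : ContDiff ℝ k (fun t : ℝ => Complex.exp (-Complex.I * t)) :=
    Complex.contDiff_exp.comp (contDiff_const.mul Complex.ofRealCLM.contDiff)
  have he : expChar ξ = (fun t : ℝ => Complex.exp (-Complex.I * t)) ∘ (innerSL ℝ ξ) := by
    funext y
    simp [expChar, real_inner_comm]
  rw [he, (innerSL ℝ ξ).iteratedFDeriv_comp_right hsm x le_rfl]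
  refine (ContinuousMultilinearMap.norm_compContinuousLinearMap_le _ _).trans ?_
  rw [norm_iteratedFDeriv_eq_norm_iteratedDeriv, iteratedDeriv_cexp_neg_I_mul]
  have : ‖Complex.exp (-Complex.I * ((innerSL ℝ ξ x : ℝ) : ℂ))‖ = 1 := by
    simp [Complex.norm_exp]
  rw [norm_mul, this]
  simp

theorem norm_expChar {d : ℕ} (ξ x : Rd d) : ‖expChar ξ x‖ = 1 := by
  unfold expChar
  simp [Complex.norm_exp]

theorem norm_iteratedFDeriv_modulate_le {d : ℕ} {V : Opens (Rd d)} (κ : 𝓓(V, ℂ)) (ξ : Rd d)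
    {N : ℕ} {M : ℝ} (hM : ∀ i ≤ N, ∀ x, ‖iteratedFDeriv ℝ i κ x‖ ≤ M) (i : ℕ) (hi : i ≤ N)
    (x : Rd d) : ‖iteratedFDeriv ℝ i (modulate κ ξ) x‖ ≤ M * (1 + ‖ξ‖) ^ N := by
  have hM0 : 0 ≤ M := (norm_nonneg _).trans (hM 0 (zero_le) x)
  have h := norm_iteratedFDeriv_mul_le (𝕜 := ℝ) κ.contDiff (contDiff_expChar ξ) x (n := i)
    (by exact_mod_cast le_top)
  change ‖iteratedFDeriv ℝ i (fun y => κ y * expChar ξ y) x‖ ≤ _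
  refine (h.trans (c := M * (1 + ‖ξ‖) ^ i) ?_).trans ?_
  · rw [add_pow, Finset.mul_sum]
    refine Finset.sum_le_sum fun j hj => ?_
    have hj' : j ≤ i := Nat.lt_succ_iff.1 (Finset.mem_range.1 hj)
    have h1 := mul_le_mul (hM j (hj'.trans hi) x) (norm_iteratedFDeriv_expChar_le ξ x (i - j))
      (norm_nonneg _) hM0
    have h2 := mul_le_mul_of_nonneg_left h1 (Nat.cast_nonneg (i.choose j) : (0 : ℝ) ≤ _)
    calc _ = (i.choose j : ℝ) * (‖iteratedFDeriv ℝ j κ x‖ *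
          ‖iteratedFDeriv ℝ (i - j) (expChar ξ) x‖) := by ring
      _ ≤ _ := h2
      _ = _ := by ring
  · exact mul_le_mul_of_nonneg_left (pow_le_pow_right₀ (by linarith [norm_nonneg ξ]) hi) hM0

/-! ### Reindexing and dilating cut-off sequences. -/

theorem IsCutoffSeq.comp_mul {d : ℕ} {V : Opens (Rd d)} {x₀ : Rd d} {χ : ℕ → 𝓓(V, ℂ)}
    (h : IsCutoffSeq V x₀ χ) {L : ℕ} (hL : 1 ≤ L) :
    IsCutoffSeq V x₀ (fun k => χ (L * k)) := by
  obtain ⟨W, U, hW, hU, hx, h1, h2, h3, h4, h5, h6⟩ := h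
  refine ⟨W, U, hW, hU, hx, h1, h2, h3, h4, fun n hn => h5 _ (Nat.mul_pos hL hn), fun j => ?_⟩
  obtain ⟨C, hC, hb⟩ := h6 j
  have hL1 : (1 : ℝ) ≤ L := by exact_mod_cast hL
  refine ⟨C * L, by positivity, fun n hn m hm x => ?_⟩
  refine (hb (L * n) (Nat.mul_pos hL hn) m (hm.trans (Nat.le_mul_of_pos_left n hL)) x).trans ?_
  push_cast
  rw [← mul_assoc C]
  exact mul_le_mul_of_nonneg_right (le_mul_of_one_le_right hC.le hL1) (by positivity)

theorem norm_iteratedFDeriv_dilate {d : ℕ} {g : Rd d → ℂ} (hg : ContDiff ℝ ∞ g) (c : Rd d)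
    {s : ℝ} (hs : 0 ≤ s) (i : ℕ) (x : Rd d) :
    ‖iteratedFDeriv ℝ i (fun y => g (s • y + c)) x‖ =
      s ^ i * ‖iteratedFDeriv ℝ i g (s • x + c)‖ := by
  have hsm : ContDiff ℝ i (fun z => g (z + c)) :=
    (hg.comp (contDiff_id.add contDiff_const)).of_le (by exact_mod_cast le_top)
  rw [iteratedFDeriv_comp_const_smul s hsm]
  simp only [iteratedFDeriv_comp_add_right]
  rw [norm_smul, norm_pow, Real.norm_of_nonneg hs]

/-- Composing with a dilation about `x₀` of ratio `s ≥ 1` contracts supports into any prescribed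
ball. It multiplies derivatives of order `j + m` by `s ^ (j + m)`, a geometric factor that the
analytic-type bounds absorb. -/
theorem IsCutoffSeq.exists_shrink {d : ℕ} {Ω V : Opens (Rd d)} {x₀ : Rd d} {κ : ℕ → 𝓓(Ω, ℂ)}
    (h : IsCutoffSeq Ω x₀ κ) {O : Set (Rd d)} (hO : O ∈ 𝓝 x₀) (hOV : O ⊆ V) :
    ∃ χ : ℕ → 𝓓(V, ℂ), IsCutoffSeq V x₀ χ ∧
      ∃ K : Compacts (Rd d), (K : Set (Rd d)) ⊆ O ∧ ∀ n, 1 ≤ n → tsupport (χ n) ⊆ K := by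
  obtain ⟨W, U, hW, hU, hx, h1, h2, h3, h4, h5, h6⟩ := h
  obtain ⟨r, hr, hrO⟩ := Metric.nhds_basis_closedBall.mem_iff.1 hO
  obtain ⟨R, hR⟩ := h3.isBounded.subset_closedBall x₀
  set s : ℝ := max 1 (R / r) with hs
  have hs1 : 1 ≤ s := le_max_left _ _
  have hs0 : 0 < s := zero_lt_one.trans_le hs1
  have hsR : R ≤ s * r := (div_le_iff₀ hr).1 (le_max_right _ _)
  set c : Rd d := (1 - s) • x₀ with hc
  set φ : Rd d ≃ₜ Rd d := (Homeomorph.smulOfNeZero s hs0.ne').trans (Homeomorph.addRight c)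
    with hφ
  have hφx : ∀ x, φ x = s • x + c := fun x => rfl
  have hφ0 : φ x₀ = x₀ := by rw [hφx, hc, ← add_smul]; simp
  have hcl : ∀ A : Set (Rd d), closure (φ ⁻¹' A) = φ ⁻¹' closure A := fun A =>
    (φ.preimage_closure A).symm
  have hball : closure (φ ⁻¹' U) ⊆ Metric.closedBall x₀ r := by
    intro x hx
    rw [hcl] at hx
    have h7 := hR hx
    rw [Metric.mem_closedBall, dist_eq_norm] at h7 ⊢
    have h8 : φ x - x₀ = s • (x - x₀) := by
      rw [hφx, hc]; module
    rw [h8, norm_smul, Real.norm_of_nonneg hs0.le] at h7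
    exact le_of_mul_le_mul_left (h7.trans hsR) hs0
  have hts : ∀ n, 1 ≤ n → tsupport (fun x => κ n (φ x)) ⊆ φ ⁻¹' U := by
    intro n hn
    have : tsupport (fun x => κ n (φ x)) = φ ⁻¹' tsupport (κ n) := by
      rw [tsupport, tsupport, ← hcl]; rfl
    rw [this]
    exact preimage_mono (h5 n hn).1
  have hUV : closure (φ ⁻¹' U) ⊆ V := hball.trans (hrO.trans hOV)
  -- Nothing controls the support of `κ 0`, so index `0` receives the zero function.
  have hex : ∀ n : ℕ, ∃ θ : 𝓓(V, ℂ), 1 ≤ n → (θ : Rd d → ℂ) = fun x => κ n (φ x) := by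
    intro n
    by_cases hn : 1 ≤ n
    · refine ⟨⟨fun x => κ n (φ x), ?_, ?_, ?_⟩, fun _ => rfl⟩
      · exact (κ n).contDiff.comp ((contDiff_const_smul s).add contDiff_const)
      · exact (κ n).hasCompactSupport.comp_homeomorph φ
      · exact (hts n hn).trans (subset_closure.trans hUV)
    · exact ⟨0, fun h => absurd h hn⟩
  choose χ hχ using hex
  refine ⟨χ, ⟨φ ⁻¹' W, φ ⁻¹' U, hW.preimage φ.continuous, hU.preimage φ.continuous, ?_, ?_, ?_, ?_,
    hUV, ?_, ?_⟩, ⟨Metric.closedBall x₀ r, isCompact_closedBall x₀ r⟩, hrO, ?_⟩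
  · rwa [mem_preimage, hφ0]
  · rw [hcl]; exact φ.isCompact_preimage.2 h1
  · rw [hcl]; exact preimage_mono h2
  · rw [hcl]; exact φ.isCompact_preimage.2 h3
  · intro n hn
    rw [hχ n hn]
    exact ⟨hts n hn, fun x hx => (h5 n hn).2 _ hx⟩
  · intro j
    obtain ⟨C, hC, hb⟩ := h6 j
    refine ⟨C * s ^ (j + 1), by positivity, fun n hn m hm x => ?_⟩
    rw [hχ n hn]
    have := norm_iteratedFDeriv_dilate (κ n).contDiff c hs0.le (j + m) x
    simp only [hφx]
    rw [this]
    have h9 := hb n hn m hm (s • x + c)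
    have hsj : (1 : ℝ) ≤ s ^ j := one_le_pow₀ hs1
    calc s ^ (j + m) * ‖iteratedFDeriv ℝ (j + m) (κ n) (s • x + c)‖
        ≤ s ^ (j + m) * (C * (C * n) ^ m) := by gcongr
      _ = (C * s ^ j) * (C * s * n) ^ m := by ring
      _ ≤ (C * s ^ (j + 1)) * (C * s ^ (j + 1) * n) ^ m := by
        have h10 : s ^ j ≤ s ^ (j + 1) := pow_le_pow_right₀ hs1 (Nat.le_succ j)
        have h11 : s ≤ s ^ (j + 1) := le_self_pow₀ hs1 (Nat.succ_ne_zero j)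
        gcongr
  · intro n hn
    rw [hχ n hn]
    exact (hts n hn).trans (subset_closure.trans hball)

/-! ### Fourier decay of cut-offs and the convolution formula. -/

open scoped FourierTransform

section Fourier

variable {E : Type*} [NormedAddCommGroup E] [InnerProductSpace ℝ E] [FiniteDimensional ℝ E]
  [MeasurableSpace E] [BorelSpace E]

theorem pow_mul_norm_fourier_le {f : E → ℂ} (hf : ContDiff ℝ ∞ f) (hs : HasCompactSupport f)
    (n : ℕ) (w : E) : ‖w‖ ^ n * ‖𝓕 f w‖ ≤ ∫ v, ‖iteratedFDeriv ℝ n f v‖ := by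
  have hint : ∀ k : ℕ, (k : ℕ∞) ≤ ⊤ → Integrable (iteratedFDeriv ℝ k f) := fun k _ =>
    (hf.continuous_iteratedFDeriv (by exact_mod_cast le_top)).integrable_of_hasCompactSupport
      (hs.iteratedFDeriv k)
  have h := congrFun (Real.fourier_iteratedFDeriv (N := ⊤) hf hint (n := n) le_top) w
  have h1 : ‖𝓕 (iteratedFDeriv ℝ n f) w‖ ≤ ∫ v, ‖iteratedFDeriv ℝ n f v‖ :=
    VectorFourier.norm_fourierIntegral_le_integral_norm _ _ _ _ _
  rw [h] at h1
  -- Evaluating the transformed derivative on `(w, …, w)` yields `(2π)^n ‖w‖^(2n) ‖𝓕 f w‖`; one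
  -- factor `‖w‖^n` is then cancelled.
  have h2 := ContinuousMultilinearMap.le_opNorm
    (VectorFourier.fourierPowSMulRight (-innerSL ℝ) (𝓕 f) w n) (fun _ => w)
  rw [VectorFourier.fourierPowSMulRight_apply] at h2
  simp only [Finset.prod_const, Finset.card_univ, Fintype.card_fin, norm_smul, norm_pow, norm_neg,
    norm_mul, neg_apply, Complex.norm_I, mul_one, Complex.norm_real, Complex.norm_ofNat, Real.norm_eq_abs,
    abs_of_pos Real.pi_pos] at h2
  have hin : (innerSL ℝ) w w = ‖w‖ ^ 2 := real_inner_self_eq_norm_sq w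
  rw [hin, abs_of_nonneg (sq_nonneg _)] at h2
  rcases eq_or_ne w 0 with rfl | hw
  · rcases Nat.eq_zero_or_pos n with rfl | hn
    · simp only [pow_zero, one_mul, mul_one] at h2 ⊢
      exact h2.trans h1
    · rw [norm_zero, zero_pow hn.ne', zero_mul]
      exact integral_nonneg fun _ => norm_nonneg _
  · have hw0 : 0 < ‖w‖ ^ n := pow_pos (norm_pos_iff.2 hw) n
    have hpi : (1 : ℝ) ≤ (2 * Real.pi) ^ n :=
      one_le_pow₀ (by linarith [Real.two_le_pi])
    have h3 : (‖w‖ ^ n * ‖𝓕 f w‖) * ‖w‖ ^ n ≤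
        (∫ v, ‖iteratedFDeriv ℝ n f v‖) * ‖w‖ ^ n := by
      calc (‖w‖ ^ n * ‖𝓕 f w‖) * ‖w‖ ^ n ≤ (2 * Real.pi) ^ n *
            ((‖w‖ ^ n * ‖𝓕 f w‖) * ‖w‖ ^ n) := le_mul_of_one_le_left (by positivity) hpi
        _ = (2 * Real.pi) ^ n * ((‖w‖ ^ 2) ^ n * ‖𝓕 f w‖) := by ring
        _ ≤ _ := h2
        _ ≤ _ := mul_le_mul_of_nonneg_right h1 hw0.le
    exact le_of_mul_le_mul_right h3 hw0

/-- This is `∫ (𝓕 u) g = ∫ u (𝓕 g)` with `u` the inverse transform of `χ` and `g` the modulation of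
`h`. Only `χ` is inverted, so `𝓕 h` need not be integrable. -/
theorem fourier_mul_eq_integral {χ h : E → ℂ} (hc : Continuous χ) (hχ : Integrable χ)
    (hFχ : Integrable (𝓕 χ)) (hh : Integrable h) (ξ : E) :
    𝓕 (fun x => χ x * h x) ξ = ∫ η, 𝓕 χ (-η) * 𝓕 h (η + ξ) := by
  set u : E → ℂ := fun η => 𝓕 χ (-η) with hu
  have hFu : 𝓕 u = χ := by
    rw [hu, ← Real.fourierInv_eq_fourier_comp_neg]
    exact hc.fourierInv_fourier_eq hχ hFχ
  set g : E → ℂ := fun x => Real.fourierChar (-inner ℝ x ξ) • h x with hg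
  have hgi : Integrable g := (Real.fourierIntegral_convergent_iff ξ).2 hh
  have hui : Integrable u := hFχ.comp_neg
  have hFg : ∀ η, 𝓕 g η = 𝓕 h (η + ξ) := by
    intro η
    rw [Real.fourier_eq, Real.fourier_eq]
    congr 1
    funext x
    rw [hg, smul_smul, ← AddChar.map_add_eq_mul, inner_add_right, neg_add]
  have key := VectorFourier.integral_fourierIntegral_smul_eq_flip (μ := volume) (ν := volume)
    (L := innerₗ E) Real.continuous_fourierChar continuous_inner hui hgi
  rw [flip_innerₗ] at key
  have e1 : ∀ v, VectorFourier.fourierIntegral Real.fourierChar volume (innerₗ E) u v = χ v :=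
    fun v => congrFun hFu v
  have e2 : ∀ v, VectorFourier.fourierIntegral Real.fourierChar volume (innerₗ E) g v =
    𝓕 h (v + ξ) := hFg
  simp only [e1, e2, smul_eq_mul] at key
  rw [← key, Real.fourier_eq]
  congr 1
  funext x
  simp only [hg, Circle.smul_def, smul_eq_mul]
  ring

end Fourier

theorem fourierHat_eq {d : ℕ} (g : Rd d → ℂ) (ξ : Rd d) :
    fourierHat g ξ = 𝓕 g ((2 * Real.pi)⁻¹ • ξ) := by
  rw [fourierHat, Real.fourier_eq']
  congr 1
  funext x
  rw [expChar, smul_eq_mul, inner_smul_right]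
  congr 2
  push_cast
  field_simp

theorem integral_norm_iteratedFDeriv_le {d : ℕ} {f : Rd d → ℂ} {K : Set (Rd d)} (hK : IsCompact K)
    (hs : tsupport f ⊆ K) (n : ℕ) {M : ℝ}
    (hM : ∀ x, ‖iteratedFDeriv ℝ n f x‖ ≤ M) :
    ∫ x, ‖iteratedFDeriv ℝ n f x‖ ≤ M * volume.real K := by
  have hz : ∀ x, x ∉ K → ‖iteratedFDeriv ℝ n f x‖ = 0 := fun x hx => by
    rw [norm_eq_zero]
    by_contra h
    exact hx (hs (support_iteratedFDeriv_subset n h))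
  rw [← setIntegral_eq_integral_of_forall_compl_eq_zero hz]
  refine (le_abs_self _).trans ?_
  exact norm_setIntegral_le_of_norm_le_const (f := fun x => ‖iteratedFDeriv ℝ n f x‖)
    hK.measure_lt_top fun x _ => (norm_norm _).trans_le (hM x)

theorem one_add_pow_mul_norm_fourier_le {d : ℕ} {f : Rd d → ℂ} {K : Set (Rd d)} (hK : IsCompact K)
    (hs : tsupport f ⊆ K) (hf : ContDiff ℝ ∞ f) {k : ℕ} {M₀ M₁ : ℝ}
    (h₀ : ∀ x, ‖iteratedFDeriv ℝ 0 f x‖ ≤ M₀) (h₁ : ∀ x, ‖iteratedFDeriv ℝ k f x‖ ≤ M₁)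
    (w : Rd d) :
    (1 + ‖w‖) ^ k * ‖𝓕 f w‖ ≤ 2 ^ k * ((M₀ + M₁) * volume.real K) := by
  have hc : HasCompactSupport f := hK.of_isClosed_subset (isClosed_tsupport f) hs
  have e0 := (pow_mul_norm_fourier_le hf hc 0 w).trans
    (integral_norm_iteratedFDeriv_le hK hs 0 h₀)
  have e1 := (pow_mul_norm_fourier_le hf hc k w).trans
    (integral_norm_iteratedFDeriv_le hK hs k h₁)
  have h2 : (1 + ‖w‖) ^ k ≤ 2 ^ k * (1 + ‖w‖ ^ k) := by
    refine (add_pow_le zero_le_one (norm_nonneg w) k).trans ?_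
    rw [one_pow]
    exact mul_le_mul_of_nonneg_right (pow_le_pow_right₀ one_le_two (Nat.sub_le k 1))
      (by positivity)
  calc _ ≤ 2 ^ k * (1 + ‖w‖ ^ k) * ‖𝓕 f w‖ := mul_le_mul_of_nonneg_right h2 (norm_nonneg _)
    _ = 2 ^ k * (‖w‖ ^ 0 * ‖𝓕 f w‖ + ‖w‖ ^ k * ‖𝓕 f w‖) := by ring
    _ ≤ 2 ^ k * (M₀ * volume.real K + M₁ * volume.real K) := by gcongr
    _ = _ := by ring

/-- The `d + 1` derivatives outside the analytic count supply the integrable weight; the other `n`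
give the analytic decay. -/
theorem IsCutoffSeq.fourier_decay {d : ℕ} {V : Opens (Rd d)} {x₀ : Rd d} {χ : ℕ → 𝓓(V, ℂ)}
    (h : IsCutoffSeq V x₀ χ) : ∃ A : ℝ, 1 ≤ A ∧ ∀ n, 1 ≤ n → ∀ w,
      ‖𝓕 (χ n : Rd d → ℂ) w‖ ≤ A / (1 + ‖w‖) ^ (d + 1) ∧
      ‖𝓕 (χ n : Rd d → ℂ) w‖ ≤ A * (A * n / (1 + ‖w‖)) ^ n / (1 + ‖w‖) ^ (d + 1) := by
  obtain ⟨W, U, hW, hU, hx, -, -, hK, -, h5, h6⟩ := h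
  obtain ⟨C₀, hC₀, hb₀⟩ := h6 0
  obtain ⟨C₁, hC₁, hb₁⟩ := h6 (d + 1)
  set v := volume.real (closure U)
  have hv : 0 ≤ v := measureReal_nonneg
  set B := 1 + (C₀ + C₁) * v with hB
  have hB1 : 1 ≤ B := by rw [hB]; nlinarith [mul_nonneg (add_pos hC₀ hC₁).le hv]
  set D := 1 + C₁ with hD
  have hD1 : 1 ≤ D := by linarith
  have h2d : (1 : ℝ) ≤ 2 ^ (d + 1) := one_le_pow₀ one_le_two
  set A := 2 ^ (d + 1) * B * (2 * D) with hA
  have hBA : 2 ^ (d + 1) * B ≤ A := le_mul_of_one_le_right (by positivity) (by linarith)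
  have hDA : 2 * D ≤ A := le_mul_of_one_le_left (by positivity)
    (one_le_mul_of_one_le_of_one_le h2d hB1)
  refine ⟨A, by linarith, fun n hn w => ?_⟩
  have hn1 : (1 : ℝ) ≤ n := by exact_mod_cast hn
  have hw : 0 < 1 + ‖w‖ := by positivity
  have hs : tsupport (χ n) ⊆ closure U := (h5 n hn).1.trans subset_closure
  have hd0 : ∀ x, ‖iteratedFDeriv ℝ 0 (χ n) x‖ ≤ C₀ := fun x => by
    simpa using hb₀ n hn 0 (Nat.zero_le n) x
  constructor
  · rw [le_div_iff₀ (by positivity), mul_comm]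
    have hd1 : ∀ x, ‖iteratedFDeriv ℝ (d + 1) (χ n) x‖ ≤ C₁ := fun x => by
      simpa using hb₁ n hn 0 (Nat.zero_le n) x
    refine (one_add_pow_mul_norm_fourier_le hK hs (χ n).contDiff hd0 hd1 w).trans
      (le_trans ?_ hBA)
    gcongr
    linarith
  · rw [le_div_iff₀ (by positivity), div_pow, mul_div_assoc', le_div_iff₀ (by positivity)]
    have hd1 : ∀ x, ‖iteratedFDeriv ℝ (d + 1 + n) (χ n) x‖ ≤ C₁ * (D * n) ^ n := fun x => by
      refine (hb₁ n hn n le_rfl x).trans ?_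
      gcongr
      linarith
    have hDn : 1 ≤ (D * n) ^ n := one_le_pow₀ (one_le_mul_of_one_le_of_one_le hD1 hn1)
    calc ‖𝓕 (χ n : Rd d → ℂ) w‖ * (1 + ‖w‖) ^ (d + 1) * (1 + ‖w‖) ^ n
        = (1 + ‖w‖) ^ (d + 1 + n) * ‖𝓕 (χ n : Rd d → ℂ) w‖ := by ring
      _ ≤ 2 ^ (d + 1 + n) * ((C₀ + C₁ * (D * n) ^ n) * v) :=
        one_add_pow_mul_norm_fourier_le hK hs (χ n).contDiff hd0 hd1 w
      _ ≤ 2 ^ (d + 1 + n) * ((C₀ * (D * n) ^ n + C₁ * (D * n) ^ n) * v) := by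
        gcongr
        exact le_mul_of_one_le_right hC₀.le hDn
      _ = 2 ^ (d + 1) * ((C₀ + C₁) * v) * (2 * D * n) ^ n := by
        rw [mul_assoc 2 D, mul_pow 2]; ring
      _ ≤ 2 ^ (d + 1) * B * (2 * D * n) ^ n := by gcongr; linarith
      _ ≤ A * (A * n) ^ n := by gcongr

/-! ### Propagation of decay to a smaller cone. -/

theorem IsConicNhd.exists_shrink {d : ℕ} {ξ₀ : Rd d} {Γ : Set (Rd d)} (h : IsConicNhd ξ₀ Γ)
    (hξ₀ : ξ₀ ≠ 0) : ∃ Γ' : Set (Rd d), IsConicNhd ξ₀ Γ' ∧ ∃ c : ℝ, 0 < c ∧ c < 1 ∧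
      ∀ ξ ∈ Γ', ∀ ζ, ‖ζ‖ ≤ c * ‖ξ‖ → ζ + ξ ∈ Γ := by
  obtain ⟨hop, hmem, hcone⟩ := h
  obtain ⟨ρ, hρ, hball⟩ := Metric.isOpen_iff.1 hop ξ₀ hmem
  set r := ρ / 2 with hr
  have hr0 : 0 < r := half_pos hρ
  have hn : 0 < ‖ξ₀‖ := norm_pos_iff.2 hξ₀
  -- The cone over the ball of radius `r = ρ / 2`. If `t • ξ` lies in it then `‖t • ξ‖ ≤ ‖ξ₀‖ + r`,
  -- so this `c` gives `‖t • ζ‖ ≤ r`, and the two errors add up to less than `ρ`.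
  refine ⟨{ξ | ∃ t : ℝ, 0 < t ∧ t • ξ ∈ Metric.ball ξ₀ r}, ⟨?_, ?_, ?_⟩, r / (‖ξ₀‖ + r),
    by positivity, (div_lt_one (by positivity)).2 (by linarith), ?_⟩
  · have : {ξ : Rd d | ∃ t : ℝ, 0 < t ∧ t • ξ ∈ Metric.ball ξ₀ r} =
        ⋃ t ∈ Ioi (0 : ℝ), (fun ξ => t • ξ) ⁻¹' Metric.ball ξ₀ r := by
      ext ξ; simp
    rw [this]
    exact isOpen_biUnion fun t _ => Metric.isOpen_ball.preimage (continuous_const_smul t)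
  · exact ⟨1, one_pos, by simpa using hr0⟩
  · rintro ξ ⟨t, ht, htξ⟩ s hs
    exact ⟨t / s, by positivity, by rwa [smul_smul, div_mul_cancel₀ _ hs.ne']⟩
  · rintro ξ ⟨t, ht, htξ⟩ ζ hζ
    rw [Metric.mem_ball, dist_eq_norm] at htξ
    have h1 : ‖t • ξ‖ ≤ ‖ξ₀‖ + r := by
      have := norm_add_le ξ₀ (t • ξ - ξ₀)
      rw [add_sub_cancel] at this
      linarith
    have h2 : ‖t • ζ‖ ≤ r := by
      rw [norm_smul, Real.norm_of_nonneg ht.le] at h1 ⊢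
      calc t * ‖ζ‖ ≤ t * (r / (‖ξ₀‖ + r) * ‖ξ‖) := by gcongr
        _ = r / (‖ξ₀‖ + r) * (t * ‖ξ‖) := by ring
        _ ≤ r / (‖ξ₀‖ + r) * (‖ξ₀‖ + r) := by gcongr
        _ = r := div_mul_cancel₀ _ (by positivity)
    have h3 : t • (ζ + ξ) ∈ Γ := by
      refine hball ?_
      rw [Metric.mem_ball, dist_eq_norm]
      have e : t • (ζ + ξ) - ξ₀ = t • ζ + (t • ξ - ξ₀) := by rw [smul_add]; abel
      rw [e]
      have := norm_add_le (t • ζ) (t • ξ - ξ₀)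
      linarith
    have := hcone _ h3 t⁻¹ (by positivity)
    rwa [smul_smul, inv_mul_cancel₀ ht.ne', one_smul] at this

theorem integrable_one_add_norm_pow (d : ℕ) :
    Integrable (fun w : Rd d => 1 / (1 + ‖w‖) ^ (d + 1)) := by
  have h := integrable_one_add_norm (E := Rd d) (μ := volume) (r := (d + 1 : ℕ)) (by simp)
  refine h.congr (Eventually.of_forall fun w => ?_)
  simp only
  rw [Real.rpow_neg (by positivity), Real.rpow_natCast, one_div]

theorem IsCutoffSeq.fourierHat_mul_le {d : ℕ} {V : Opens (Rd d)} {x₀ : Rd d} {χ : ℕ → 𝓓(V, ℂ)}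
    (hχ : IsCutoffSeq V x₀ χ) {Γ Γ' : Set (Rd d)} {c : ℝ} (hc0 : 0 < c) (hc1 : c < 1)
    (hΓ : ∀ ξ ∈ Γ', ∀ ζ, ‖ζ‖ ≤ c * ‖ξ‖ → ζ + ξ ∈ Γ) {D : ℝ} (hD : 0 < D) :
    ∃ B : ℝ, 0 < B ∧ ∀ n : ℕ, 1 ≤ n → ∀ h : Rd d → ℂ, Integrable h → ∀ M : ℝ,
      (∀ η, ‖fourierHat h η‖ ≤ M) →
      (∀ η ∈ Γ, ‖fourierHat h η‖ ≤ M * (D * n / (1 + ‖η‖)) ^ n) → ∀ ξ ∈ Γ',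
      ‖fourierHat (fun x => χ n x * h x) ξ‖ ≤ B * M ∧
      ‖fourierHat (fun x => χ n x * h x) ξ‖ ≤ B * M * (B * n / (1 + ‖ξ‖)) ^ n := by
  obtain ⟨A, hA, hdec⟩ := hχ.fourier_decay
  have hA0 : 0 < A := by linarith
  have hpi := Real.pi_pos
  have hpi2 := Real.two_le_pi
  set I := ∫ w : Rd d, 1 / (1 + ‖w‖) ^ (d + 1) with hI
  have hI0 : 0 ≤ I := integral_nonneg fun w => by positivity
  have hJ := integrable_one_add_norm_pow d
  have h1c : 0 < 1 - c := by linarith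
  set c' := c / (2 * Real.pi) with hc'
  have hc'0 : 0 < c' := by positivity
  have hc'1 : c' ≤ 1 := (div_le_one (by positivity)).2 (by linarith)
  set P := D / (1 - c) + A / c' with hP
  have hP0 : 0 < P := by positivity
  refine ⟨A * I + P, by positivity, fun n hn h hh M hM hMΓ ξ hξ => ?_⟩
  have hn0 : (0 : ℝ) < n := by exact_mod_cast hn
  have hM0 : 0 ≤ M := (norm_nonneg _).trans (hM 0)
  have hξ0 : 0 < 1 + ‖ξ‖ := by positivity
  have hχi : Integrable (χ n : Rd d → ℂ) :=
    (χ n).continuous.integrable_of_hasCompactSupport (χ n).hasCompactSupport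
  have hFcont : Continuous (𝓕 (χ n : Rd d → ℂ)) :=
    VectorFourier.fourierIntegral_continuous Real.continuous_fourierChar
      (by exact continuous_inner) hχi
  have hFi : Integrable (𝓕 (χ n : Rd d → ℂ)) := by
    refine (hJ.const_mul A).mono' hFcont.aestronglyMeasurable (Eventually.of_forall fun w => ?_)
    exact (hdec n hn w).1.trans_eq (mul_one_div _ _).symm
  have hrep : fourierHat (fun x => χ n x * h x) ξ =
      ∫ η, 𝓕 (χ n : Rd d → ℂ) (-η) * fourierHat h ((2 * Real.pi) • η + ξ) := by
    rw [fourierHat_eq, fourier_mul_eq_integral (χ n).continuous hχi hFi hh]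
    congr 1
    funext η
    rw [fourierHat_eq h, smul_add, smul_smul, inv_mul_cancel₀ (by positivity), one_smul]
  have main : ∀ Q : ℝ, 0 ≤ Q → (∀ η, ‖𝓕 (χ n : Rd d → ℂ) (-η)‖ *
      ‖fourierHat h ((2 * Real.pi) • η + ξ)‖ ≤ A * M * Q * (1 / (1 + ‖η‖) ^ (d + 1))) →
      ‖fourierHat (fun x => χ n x * h x) ξ‖ ≤ (A * I + P) * M * Q := by
    intro Q hQ hb
    rw [hrep]
    refine (norm_integral_le_of_norm_le (hJ.const_mul (A * M * Q))
      (Eventually.of_forall fun η => by rw [norm_mul]; exact hb η)).trans ?_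
    rw [integral_const_mul, ← hI]
    have : 0 ≤ P * M * Q := by positivity
    linarith
  constructor
  · have := main 1 zero_le_one fun η => by
      have h1 := (hdec n hn (-η)).1
      rw [norm_neg] at h1
      calc _ ≤ A / (1 + ‖η‖) ^ (d + 1) * M := mul_le_mul h1 (hM _) (norm_nonneg _) (by positivity)
        _ = _ := by ring
    rwa [mul_one] at this
  · have hle : (P * n / (1 + ‖ξ‖)) ^ n ≤ ((A * I + P) * n / (1 + ‖ξ‖)) ^ n := by
      gcongr
      linarith [mul_nonneg hA0.le hI0]
    refine (main _ (by positivity) fun η => ?_).trans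
      (mul_le_mul_of_nonneg_left hle (by positivity))
    have h1 := hdec n hn (-η)
    rw [norm_neg] at h1
    -- For a small shift the argument of `fourierHat h` stays in `Γ` and has size at least `(1 - c)
    -- ‖ξ‖`, so `h` provides the decay. For a large shift `‖η‖ ≥ c' ‖ξ‖`, and the cut-off provides
    -- it.
    by_cases hcase : ‖(2 * Real.pi) • η‖ ≤ c * ‖ξ‖
    · have h2 := hMΓ _ (hΓ ξ hξ _ hcase)
      have h3 : (1 - c) * (1 + ‖ξ‖) ≤ 1 + ‖(2 * Real.pi) • η + ξ‖ := by
        have := norm_sub_le ((2 * Real.pi) • η + ξ) ((2 * Real.pi) • η)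
        rw [add_sub_cancel_left] at this
        nlinarith
      have h4 : D * n / (1 + ‖(2 * Real.pi) • η + ξ‖) ≤ P * n / (1 + ‖ξ‖) := by
        calc _ ≤ D * n / ((1 - c) * (1 + ‖ξ‖)) := by gcongr
          _ = D / (1 - c) * n / (1 + ‖ξ‖) := by field_simp
          _ ≤ _ := by
            gcongr
            have : 0 ≤ A / c' := by positivity
            linarith
      calc _ ≤ A / (1 + ‖η‖) ^ (d + 1) * (M * (P * n / (1 + ‖ξ‖)) ^ n) := by
            refine mul_le_mul h1.1 (h2.trans ?_) (norm_nonneg _) (by positivity)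
            gcongr
        _ = _ := by ring
    · rw [norm_smul, Real.norm_of_nonneg (by positivity), not_le] at hcase
      have h3 : c' * (1 + ‖ξ‖) ≤ 1 + ‖η‖ := by
        have : c' * ‖ξ‖ ≤ ‖η‖ := by
          rw [hc', div_mul_eq_mul_div, div_le_iff₀ (by positivity)]
          linarith
        linarith
      have h4 : A * n / (1 + ‖η‖) ≤ P * n / (1 + ‖ξ‖) := by
        calc _ ≤ A * n / (c' * (1 + ‖ξ‖)) := by gcongr
          _ = A / c' * n / (1 + ‖ξ‖) := by field_simp
          _ ≤ _ := by
            gcongr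
            have : 0 ≤ D / (1 - c) := by positivity
            linarith
      calc _ ≤ A * (P * n / (1 + ‖ξ‖)) ^ n / (1 + ‖η‖) ^ (d + 1) * M := by
            refine mul_le_mul (h1.2.trans ?_) (hM _) (norm_nonneg _) (by positivity)
            gcongr
        _ = _ := by ring

/-! ### Choice of `ε` in terms of `k` and `ξ`. -/

/-- Optimising over `ε` a bound which is a sum of a small term of polynomial growth and a large
term of analytic decay yields analytic decay along a dilated sequence. -/
theorem exists_analytic_bound {α : Type*} {S : ℕ → α → ℝ} {X : α → ℝ} (hX : ∀ x, 1 ≤ X x)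
    {N : ℕ} {a b C ε₁ : ℝ} (ha : 0 < a) (hb : 0 < b) (hC : 0 < C) (hε₁ : ε₁ ∈ Ioo (0 : ℝ) 1)
    {Γ : Set α}
    (h : ∀ n : ℕ, 1 ≤ n → ∀ x ∈ Γ, ∀ ε ∈ Ioo 0 ε₁,
      S n x ≤ C * ε ^ b * X x ^ N + C * ε ^ (-a) ∧
      S n x ≤ C * ε ^ b * X x ^ N + C * ε ^ (-a) * (C * n / X x) ^ n) :
    ∃ L : ℕ, 1 ≤ L ∧ ∃ C' : ℝ, 0 < C' ∧ ∀ k : ℕ, 1 ≤ k → ∀ x ∈ Γ,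
      S (L * k) x ≤ C' * (C' * k / X x) ^ k := by
  set δ := ε₁ / 2 with hδ
  have hδ0 : 0 < δ := half_pos hε₁.1
  have hδ1 : δ < 1 := by have := hε₁.2; linarith
  have hδε : δ < ε₁ := half_lt_self hε₁.1
  set s : ℝ := (1 + N) / b with hs
  have hs0 : 0 < s := by positivity
  have hsb : s * b = 1 + N := div_mul_cancel₀ _ hb.ne'
  set L : ℕ := ⌈a * s⌉₊ + 1 with hL
  have hLs : a * s + 1 ≤ L := by rw [hL]; push_cast; linarith [Nat.le_ceil (a * s)]
  have hδa : 0 < δ ^ (-a) := Real.rpow_pos_of_pos hδ0 _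
  have hδb : δ ^ b ≤ 1 := Real.rpow_le_one hδ0.le hδ1.le hb.le
  set E := C + C * δ ^ (-a) with hE
  have hE0 : 0 < E := by positivity
  set P : ℝ := 2 ^ N + (C * L) ^ L with hP
  have hL0 : (0 : ℝ) < L := by positivity
  have hP2 : 2 ^ N ≤ P := by rw [hP]; linarith [pow_pos (mul_pos hC hL0) L]
  have hPL : (C * L) ^ L ≤ P := by rw [hP]; linarith [pow_pos (zero_lt_two' ℝ) N]
  have hP0 : 0 < P := lt_of_lt_of_le (by positivity) hP2
  refine ⟨L, by omega, E + P, by positivity, fun k hk x hx => ?_⟩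
  have hX0 : 0 < X x := zero_lt_one.trans_le (hX x)
  have hk0 : (0 : ℝ) < k := by exact_mod_cast hk
  have hLk : 1 ≤ L * k := Nat.mul_pos (by omega) hk
  set q : ℝ := k / X x with hq
  have hq0 : 0 < q := by positivity
  have hqX : q * X x = k := div_mul_cancel₀ _ hX0.ne'
  have hkN : (k : ℝ) ^ N ≤ (2 ^ N) ^ k := by
    rw [← pow_mul, mul_comm, pow_mul]
    gcongr
    exact_mod_cast Nat.lt_two_pow_self.le
  suffices hsuff : S (L * k) x ≤ E * (P * q) ^ k by
    refine hsuff.trans ?_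
    rw [mul_div_assoc, ← hq]
    gcongr <;> linarith
  -- For `q ≤ 1`, `s b = 1 + N` leaves `q ^ k` after `N` powers of `q` turn `X ^ N` into `k ^ N ≤ (2
  -- ^ N) ^ k`, while `L ≥ a s + 1` pays for `ε^{-a}`. For `q > 1`, `X < k`, and a fixed `ε` with
  -- the bound without decay suffices.
  rcases le_or_gt q 1 with hq1 | hq1
  · set ε := δ * q ^ (k * s) with hε
    have hqs : 0 < q ^ (k * s) := Real.rpow_pos_of_pos hq0 _
    have hεmem : ε ∈ Ioo 0 ε₁ := ⟨by positivity,
      (mul_le_of_le_one_right hδ0.le (Real.rpow_le_one hq0.le hq1 (by positivity))).trans_lt hδε⟩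
    have h1 := (h (L * k) hLk x hx ε hεmem).2
    have hA : ε ^ b * X x ^ N ≤ (P * q) ^ k := by
      have e1 : (q ^ (k * s)) ^ b = q ^ (k * (1 + N)) := by
        rw [← Real.rpow_mul hq0.le, mul_assoc, hsb, ← Real.rpow_natCast]
        push_cast; rfl
      have e2 : q ^ (k * N) ≤ q ^ N := pow_le_pow_of_le_one hq0.le hq1 (Nat.le_mul_of_pos_left N hk)
      rw [hε, Real.mul_rpow hδ0.le hqs.le, e1]
      calc δ ^ b * q ^ (k * (1 + N)) * X x ^ N ≤ 1 * q ^ (k * (1 + N)) * X x ^ N := by gcongr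
        _ = q ^ k * q ^ (k * N) * X x ^ N := by ring
        _ ≤ q ^ k * q ^ N * X x ^ N := by gcongr
        _ = (q * X x) ^ N * q ^ k := by ring
        _ ≤ (2 ^ N) ^ k * q ^ k := by rw [hqX]; gcongr
        _ ≤ P ^ k * q ^ k := by gcongr
        _ = _ := (mul_pow _ _ _).symm
    have hB : ε ^ (-a) * (C * (L * k : ℕ) / X x) ^ (L * k) ≤ δ ^ (-a) * (P * q) ^ k := by
      have e1 : (q ^ (k * s)) ^ (-a) * q ^ (L * k) ≤ q ^ k := by
        rw [← Real.rpow_mul hq0.le, ← Real.rpow_natCast, ← Real.rpow_natCast,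
          ← Real.rpow_add hq0]
        refine Real.rpow_le_rpow_of_exponent_ge hq0 hq1 ?_
        push_cast
        have := mul_le_mul_of_nonneg_right hLs hk0.le
        linarith
      have e2 : (C * (L * k : ℕ) / X x) ^ (L * k) = ((C * L) ^ L) ^ k * q ^ (L * k) := by
        rw [← pow_mul, ← mul_pow, hq]
        push_cast
        congr 1
        ring
      rw [hε, Real.mul_rpow hδ0.le hqs.le, e2]
      calc _ = δ ^ (-a) * ((C * L) ^ L) ^ k * ((q ^ (k * s)) ^ (-a) * q ^ (L * k)) := by
            generalize q ^ (L * k) = u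
            generalize ((C * (L : ℝ)) ^ L) ^ k = v
            ring
        _ ≤ δ ^ (-a) * P ^ k * q ^ k := by gcongr
        _ = _ := by rw [mul_pow, mul_assoc]
    calc S (L * k) x ≤ C * (ε ^ b * X x ^ N) +
          C * (ε ^ (-a) * (C * (L * k : ℕ) / X x) ^ (L * k)) := by
          simpa only [mul_assoc] using h1
      _ ≤ C * (P * q) ^ k + C * (δ ^ (-a) * (P * q) ^ k) := by gcongr
      _ = E * (P * q) ^ k := by rw [hE]; ring
  · have h1 := (h (L * k) hLk x hx δ ⟨hδ0, hδε⟩).1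
    have hXk : X x ≤ k := by
      have := (one_lt_div hX0).1 hq1
      exact this.le
    have hXN : 1 ≤ X x ^ N := one_le_pow₀ (hX x)
    calc S (L * k) x ≤ C * δ ^ b * X x ^ N + C * δ ^ (-a) := h1
      _ ≤ C * 1 * X x ^ N + C * δ ^ (-a) * X x ^ N := by
        have : 0 < C * δ ^ (-a) := by positivity
        refine add_le_add (by gcongr) (le_mul_of_one_le_right this.le hXN)
      _ = E * X x ^ N := by rw [hE]; ring
      _ ≤ E * (k : ℝ) ^ N := by gcongr
      _ ≤ E * (2 ^ N) ^ k := by gcongr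
      _ ≤ E * (P * q) ^ k := by
        gcongr
        exact hP2.trans (le_mul_of_one_le_right hP0.le hq1.le)

/-! ### Assembling the two estimates. -/

theorem IsCutoffSeq.exists_bound {d : ℕ} {V : Opens (Rd d)} {x₀ : Rd d} {χ : ℕ → 𝓓(V, ℂ)}
    (h : IsCutoffSeq V x₀ χ) (N : ℕ) :
    ∃ M : ℝ, 0 < M ∧ ∀ n, 1 ≤ n → ∀ i ≤ N, ∀ x, ‖iteratedFDeriv ℝ i (χ n) x‖ ≤ M := by
  obtain ⟨W, U, -, -, -, -, -, -, -, -, h6⟩ := h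
  choose C hC hb using h6
  refine ⟨∑ i ∈ Finset.range (N + 1), C i,
    Finset.sum_pos (fun i _ => hC i) Finset.nonempty_range_add_one, fun n hn i hi x => ?_⟩
  refine le_trans ?_ (Finset.single_le_sum (fun i _ => (hC i).le)
    (Finset.mem_range.2 (Nat.lt_succ_of_le hi)))
  simpa using hb i n hn 0 (Nat.zero_le n) x

theorem exists_Ioo_of_eventually {p : ℝ → Prop} (h : ∀ᶠ ε in 𝓝[>] (0 : ℝ), p ε) :
    ∃ ε₁ ∈ Ioo (0 : ℝ) 1, ∀ ε ∈ Ioo 0 ε₁, p ε := by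
  obtain ⟨u, hu, hs⟩ := mem_nhdsGT_iff_exists_Ioo_subset.1 h
  refine ⟨min u (1 / 2), ⟨lt_min hu (by norm_num), (min_le_right _ _).trans_lt (by norm_num)⟩, ?_⟩
  exact fun ε hε => hs ⟨hε.1, hε.2.trans_le (min_le_left _ _)⟩

theorem integrable_mul_of_tsupport_subset {d : ℕ} {χ f : Rd d → ℂ} {K : Set (Rd d)}
    (hK : IsCompact K) (hχ : Continuous χ) (hs : tsupport χ ⊆ K) (hf : ContinuousOn f K) :
    Integrable (fun x => χ x * f x) := by
  rw [← integrableOn_iff_integrable_of_support_subset (s := K)]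
  · exact (hχ.continuousOn.mul hf).integrableOn_compact hK
  · intro x hx
    refine hs (subset_tsupport χ ?_)
    intro h0
    exact hx (by simp [h0])

theorem norm_integral_le_of_tsupport_subset {d : ℕ} {f : Rd d → ℂ} {K : Set (Rd d)}
    (hK : IsCompact K) {C : ℝ} (hz : ∀ x, x ∉ K → f x = 0) (hC : ∀ x ∈ K, ‖f x‖ ≤ C) :
    ‖∫ x, f x‖ ≤ C * volume.real K := by
  rw [← setIntegral_eq_integral_of_forall_compl_eq_zero hz]
  exact norm_setIntegral_le_of_norm_le_const hK.measure_lt_top hC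

theorem IsCutoffSeq.exists_norm_fourierHat_le {d : ℕ} {Ω V : Opens (Rd d)} {x₀ ξ₀ : Rd d}
    (hξ₀ : ξ₀ ≠ 0) (F : moderate Ω) {κ : ℕ → 𝓓(Ω, ℂ)} (hκ : IsCutoffSeq Ω x₀ κ)
    {χ : ℕ → 𝓓(V, ℂ)} (hχ : IsCutoffSeq V x₀ χ)
    (hκχ : ∀ n, 1 ≤ n → ∀ x ∈ tsupport (χ n), κ n x = 1)
    {Γ : Set (Rd d)} (hΓ : IsConicNhd ξ₀ Γ) {a C ε₀ : ℝ} (ha : 0 < a) (hC : 0 < C)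
    (hε₀ : ε₀ ∈ Ioo (0 : ℝ) 1)
    (hest : ∀ n : ℕ, 1 ≤ n → ∀ ξ ∈ Γ, ∀ ε ∈ Ioo 0 ε₀,
        ‖fourierHat (fun x => κ n x * F.1 ε x) ξ‖ ≤ C * ε ^ (-a) * (C * n / (1 + ‖ξ‖)) ^ n) :
    ∃ Γ' : Set (Rd d), IsConicNhd ξ₀ Γ' ∧ ∃ a' B ε₁ : ℝ, 0 < a' ∧ 0 < B ∧ ε₁ ∈ Ioo (0 : ℝ) 1 ∧
      ∀ n : ℕ, 1 ≤ n → ∀ ξ ∈ Γ', ∀ ε ∈ Ioo 0 ε₁,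
        ‖fourierHat (fun x => χ n x * F.1 ε x) ξ‖ ≤ B * ε ^ (-a') ∧
        ‖fourierHat (fun x => χ n x * F.1 ε x) ξ‖ ≤
          B * ε ^ (-a') * (B * n / (1 + ‖ξ‖)) ^ n := by
  obtain ⟨Mκ, hMκ, hκb⟩ := hκ.exists_bound 0
  obtain ⟨W, U, -, -, -, -, -, hU, hUΩ, h5, -⟩ := hκ
  obtain ⟨a₁, C₂, hev⟩ := F.2.2 (closure U) hU hUΩ 0
  obtain ⟨ε₂, hε₂, hF⟩ := exists_Ioo_of_eventually hev
  obtain ⟨Γ', hΓ', c, hc0, hc1, hcone⟩ := hΓ.exists_shrink hξ₀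
  obtain ⟨B, hB, hmul⟩ := hχ.fourierHat_mul_le hc0 hc1 hcone hC
  set v := volume.real (closure U)
  have hv : 0 ≤ v := measureReal_nonneg
  set D := C + Mκ * |C₂| * v with hD
  have hD0 : 0 < D := by positivity
  -- The exponent `a + |a₁|` dominates both the loss `ε^{-a}` on the cone and the moderate growth
  -- `ε^{a₁}`, which bounds the transform at all frequencies.
  refine ⟨Γ', hΓ', a + |a₁|, B * D + B, min ε₀ ε₂, by positivity, by positivity,
    ⟨lt_min hε₀.1 hε₂.1, (min_le_left _ _).trans_lt hε₀.2⟩, fun n hn ξ hξ ε hε => ?_⟩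
  have hε0 : 0 < ε := hε.1
  have hεε₀ : ε ∈ Ioo 0 ε₀ := ⟨hε0, hε.2.trans_le (min_le_left _ _)⟩
  have hεε₂ : ε ∈ Ioo 0 ε₂ := ⟨hε0, hε.2.trans_le (min_le_right _ _)⟩
  have hε1 : ε ≤ 1 := (hεε₀.2.trans hε₀.2).le
  have hea : ε ^ (-a) ≤ ε ^ (-(a + |a₁|)) :=
    Real.rpow_le_rpow_of_exponent_ge hε0 hε1 (by linarith [abs_nonneg a₁])
  have hea₁ : ε ^ a₁ ≤ ε ^ (-(a + |a₁|)) :=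
    Real.rpow_le_rpow_of_exponent_ge hε0 hε1 (by linarith [neg_abs_le a₁])
  have hp0 : 0 < ε ^ (-(a + |a₁|)) := Real.rpow_pos_of_pos hε0 _
  have hs : tsupport (κ n) ⊆ closure U := (h5 n hn).1.trans subset_closure
  have hint : Integrable (fun x => κ n x * F.1 ε x) :=
    integrable_mul_of_tsupport_subset hU (κ n).continuous hs
      ((F.2.1 ε ⟨hε0, hεε₀.2.trans hε₀.2⟩).continuousOn.mono hUΩ)
  have hM : ∀ η, ‖fourierHat (fun x => κ n x * F.1 ε x) η‖ ≤ D * ε ^ (-(a + |a₁|)) := by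
    intro η
    have h1 : ‖fourierHat (fun x => κ n x * F.1 ε x) η‖ ≤ Mκ * (|C₂| * ε ^ a₁) * v := by
      refine norm_integral_le_of_tsupport_subset hU (fun x hx => ?_) (fun x hx => ?_)
      · simp [image_eq_zero_of_notMem_tsupport fun h => hx (hs h)]
      · rw [norm_mul, norm_expChar, one_mul, norm_mul]
        have e1 := hκb n hn 0 le_rfl x
        have e2 := hF ε hεε₂ x hx
        rw [norm_iteratedFDeriv_zero] at e1 e2
        refine mul_le_mul e1 (e2.trans ?_) (norm_nonneg _) hMκ.le
        exact mul_le_mul_of_nonneg_right (le_abs_self _) (Real.rpow_nonneg hε0.le _)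
    calc _ ≤ Mκ * (|C₂| * ε ^ a₁) * v := h1
      _ ≤ Mκ * (|C₂| * ε ^ (-(a + |a₁|))) * v := by gcongr
      _ = (Mκ * |C₂| * v) * ε ^ (-(a + |a₁|)) := by ring
      _ ≤ D * ε ^ (-(a + |a₁|)) := by gcongr; linarith
  have hMΓ : ∀ η ∈ Γ, ‖fourierHat (fun x => κ n x * F.1 ε x) η‖ ≤
      D * ε ^ (-(a + |a₁|)) * (C * n / (1 + ‖η‖)) ^ n := by
    intro η hη
    refine (hest n hn η hη ε hεε₀).trans ?_
    have : C ≤ D := by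
      have : 0 ≤ Mκ * |C₂| * v := by positivity
      linarith
    gcongr
  have h2 := hmul n hn _ hint _ hM hMΓ ξ hξ
  have e : (fun x => χ n x * (κ n x * F.1 ε x)) = fun x => χ n x * F.1 ε x := by
    funext x
    by_cases hx : x ∈ tsupport (χ n)
    · rw [hκχ n hn x hx, one_mul]
    · rw [image_eq_zero_of_notMem_tsupport hx, zero_mul, zero_mul]
  rw [e] at h2
  refine ⟨h2.1.trans ?_, h2.2.trans ?_⟩
  · rw [← mul_assoc]
    gcongr
    linarith
  · rw [← mul_assoc B]
    gcongr
    · linarith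
    · have : 0 < B * D := by positivity
      linarith

theorem StronglyAssociated.exists_norm_distrFourier_sub_le {d : ℕ} {Ω V : Opens (Rd d)}
    (hV : V ≤ Ω) (F : moderate Ω) {T : Distr V}
    (hT : StronglyAssociated T (restrict hV ((null Ω).mkQ F))) {x₀ : Rd d} {χ : ℕ → 𝓓(V, ℂ)}
    (hχ : IsCutoffSeq V x₀ χ) :
    ∃ (N : ℕ) (b C ε₁ : ℝ), 0 < b ∧ 0 < C ∧ ε₁ ∈ Ioo (0 : ℝ) 1 ∧
      ∀ n : ℕ, 1 ≤ n → ∀ ξ, ∀ ε ∈ Ioo 0 ε₁,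
        ‖distrFourier (χ n) T ξ - fourierHat (fun x => χ n x * F.1 ε x) ξ‖ ≤
          C * ε ^ b * (1 + ‖ξ‖) ^ N := by
  obtain ⟨G, hG, hGT⟩ := hT
  have hnull : G - restrictNet hV F ∈ null V := (Submodule.Quotient.eq _).1 hG
  have hbd := hχ.exists_bound
  obtain ⟨W, U, -, -, -, -, -, hU, hUV, h5, -⟩ := hχ
  obtain ⟨b, hb, hO⟩ := hGT (closure U) hU hUV
  obtain ⟨N, C₁, ε₁, hC₁, hε₁, hord⟩ := exists_order_bound_of_isBigO T G.1
    (fun ε hε => (G.2.1 ε hε).continuousOn) ⟨closure U, hU⟩ hUV b hO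
  -- Strong association may use a representative `G` other than `F`. Their difference is null, and
  -- order `ε^1` is enough, whence the final exponent `min b 1`.
  obtain ⟨C₂, hev⟩ := hnull (closure U) hU hUV 0 1
  obtain ⟨ε₂, hε₂, hdiff⟩ := exists_Ioo_of_eventually hev
  obtain ⟨M, hM, hχM⟩ := hbd N
  set v := volume.real (closure U)
  have hv : 0 ≤ v := measureReal_nonneg
  refine ⟨N, min b 1, C₁ * M + |C₂| * M * v, min ε₁ ε₂, by positivity, by positivity,
    ⟨lt_min hε₁.1 hε₂.1, (min_le_left _ _).trans_lt hε₁.2⟩, fun n hn ξ ε hε => ?_⟩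
  have hε0 : 0 < ε := hε.1
  have hεε₁ : ε ∈ Ioo 0 ε₁ := ⟨hε0, hε.2.trans_le (min_le_left _ _)⟩
  have hεε₂ : ε ∈ Ioo 0 ε₂ := ⟨hε0, hε.2.trans_le (min_le_right _ _)⟩
  have hε01 : ε ∈ Ioo (0 : ℝ) 1 := ⟨hε0, hεε₁.2.trans hε₁.2⟩
  have hs : tsupport (χ n) ⊆ closure U := (h5 n hn).1.trans subset_closure
  have hX : 1 ≤ (1 + ‖ξ‖) ^ N := one_le_pow₀ (by linarith [norm_nonneg ξ])
  set θ := modulate (χ n) ξ with hθ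
  have hθx : ∀ x, θ x = χ n x * expChar ξ x := fun x => rfl
  have hθs : tsupport θ ⊆ closure U := (tsupport_mul_subset_left (f := χ n)).trans hs
  have hθz : ∀ x, x ∉ closure U → θ x = 0 := fun x hx =>
    image_eq_zero_of_notMem_tsupport fun h => hx (hθs h)
  have h1 := hord ε hεε₁ θ hθs (M * (1 + ‖ξ‖) ^ N) (by positivity)
    (norm_iteratedFDeriv_modulate_le (χ n) ξ (hχM n hn))
  have hiG : Integrable (fun x => θ x * G.1 ε x) :=
    integrable_mul_of_tsupport_subset hU θ.continuous hθs
      ((G.2.1 ε hε01).continuousOn.mono hUV)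
  have hiF : Integrable (fun x => θ x * F.1 ε x) :=
    integrable_mul_of_tsupport_subset hU θ.continuous hθs
      ((F.2.1 ε hε01).continuousOn.mono (hUV.trans hV))
  have hF : fourierHat (fun x => χ n x * F.1 ε x) ξ = ∫ x, θ x * F.1 ε x := by
    unfold fourierHat
    congr 1
    funext x
    rw [hθx]
    ring
  have h2 : ‖(∫ x, G.1 ε x * θ x) - ∫ x, θ x * F.1 ε x‖ ≤ M * (C₂ * ε ^ (1 : ℝ)) * v := by
    simp only [mul_comm (G.1 ε _)]
    rw [← integral_sub hiG hiF]
    refine norm_integral_le_of_tsupport_subset hU (fun x hx => ?_) (fun x hx => ?_)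
    · rw [hθz x hx]; simp
    · rw [← mul_sub, norm_mul]
      have e1 : ‖θ x‖ ≤ M := by
        rw [hθx, norm_mul, norm_expChar, mul_one]
        simpa using hχM n hn 0 (Nat.zero_le N) x
      have e2 := hdiff ε hεε₂ x hx
      rw [norm_iteratedFDeriv_zero] at e2
      exact mul_le_mul e1 e2 (norm_nonneg _) hM.le
  have p1 : ε ^ b ≤ ε ^ min b 1 :=
    Real.rpow_le_rpow_of_exponent_ge hε0 hε01.2.le (min_le_left _ _)
  have p2 : ε ^ (1 : ℝ) ≤ ε ^ min b 1 :=
    Real.rpow_le_rpow_of_exponent_ge hε0 hε01.2.le (min_le_right _ _)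
  have p0 : 0 < ε ^ min b 1 := Real.rpow_pos_of_pos hε0 _
  rw [hF, distrFourier, ← sub_add_sub_cancel (T θ) (∫ x, G.1 ε x * θ x)]
  refine (norm_add_le _ _).trans ((add_le_add h1 h2).trans ?_)
  have q1 : C₁ * ε ^ b * (M * (1 + ‖ξ‖) ^ N) ≤ C₁ * ε ^ min b 1 * (M * (1 + ‖ξ‖) ^ N) := by
    gcongr
  have q2 : M * (C₂ * ε ^ (1 : ℝ)) * v ≤ (|C₂| * M * v) * ε ^ min b 1 * (1 + ‖ξ‖) ^ N := by
    calc M * (C₂ * ε ^ (1 : ℝ)) * v ≤ M * (|C₂| * ε ^ min b 1) * v := by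
          have : C₂ ≤ |C₂| := le_abs_self _
          gcongr
      _ = (|C₂| * M * v) * ε ^ min b 1 := by ring
      _ ≤ _ := le_mul_of_one_le_right (by positivity) hX
  linarith

/-- A distribution strongly associated to a g-microanalytic generalized function is
microanalytic. -/
theorem GMicroanalytic.microanalytic_of_stronglyAssociated {d : ℕ} {Ω V : Opens (Rd d)}
    (hV : V ≤ Ω) {x₀ ξ₀ : Rd d} (hx₀ : x₀ ∈ V) (hξ₀ : ξ₀ ≠ 0) {f : GenFun Ω}
    (hf : GMicroanalytic f x₀ ξ₀) {T : Distr V} (hT : StronglyAssociated T (restrict hV f)) :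
    Microanalytic T x₀ ξ₀ := by
  obtain ⟨F, rfl, κ, hκ, Γ, hΓ, a, C, ε₀, ha, hC, hε₀, hest⟩ := hf
  obtain ⟨W, U, hW, -, hxW, -, -, -, -, h5, -⟩ := id hκ
  obtain ⟨χ, hχ, K, hKO, hts⟩ := hκ.exists_shrink
    (inter_mem (hW.mem_nhds hxW) (V.isOpen.mem_nhds hx₀)) inter_subset_right
  obtain ⟨Γ', hΓ', a', B, ε₁, ha', hB, hε₁, hF⟩ := hκ.exists_norm_fourierHat_le hξ₀ F hχ
    (fun n hn x hx => (h5 n hn).2 x (hKO (hts n hn hx)).1) hΓ ha hC hε₀ hest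
  obtain ⟨N, b, D, ε₂, hb, hD, hε₂, hTF⟩ := hT.exists_norm_distrFourier_sub_le hV F hχ
  obtain ⟨L, hL, C', hC', hfin⟩ := exists_analytic_bound
    (S := fun n ξ => ‖distrFourier (χ n) T ξ‖) (X := fun ξ : Rd d => 1 + ‖ξ‖)
    (fun ξ => le_add_of_nonneg_right (norm_nonneg ξ)) (N := N) (C := B + D)
    (ε₁ := min ε₁ ε₂) (Γ := Γ') ha' hb (by positivity)
    ⟨lt_min hε₁.1 hε₂.1, (min_le_left _ _).trans_lt hε₁.2⟩ (by
      intro n hn ξ hξ ε hε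
      have hε0 : 0 < ε := hε.1
      have h1 := hF n hn ξ hξ ε ⟨hε0, hε.2.trans_le (min_le_left _ _)⟩
      have h2 := hTF n hn ξ ε ⟨hε0, hε.2.trans_le (min_le_right _ _)⟩
      have h3 := norm_le_norm_sub_add (distrFourier (χ n) T ξ)
        (fourierHat (fun x => χ n x * F.1 ε x) ξ)
      have pb : 0 < ε ^ b := Real.rpow_pos_of_pos hε0 _
      have pa : 0 < ε ^ (-a') := Real.rpow_pos_of_pos hε0 _
      have h4 : D * ε ^ b * (1 + ‖ξ‖) ^ N ≤ (B + D) * ε ^ b * (1 + ‖ξ‖) ^ N := by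
        gcongr; linarith
      have h5 : B * ε ^ (-a') ≤ (B + D) * ε ^ (-a') := by gcongr; linarith
      have h6 : B * ε ^ (-a') * (B * n / (1 + ‖ξ‖)) ^ n ≤
          (B + D) * ε ^ (-a') * ((B + D) * n / (1 + ‖ξ‖)) ^ n := by
        gcongr
        all_goals linarith
      exact ⟨by linarith [h1.1], by linarith [h1.2]⟩)
  exact ⟨fun k => χ (L * k), hχ.comp_mul hL, Γ', hΓ', C', hC', hfin⟩

end Colombeau

theorem theorem6 {d : ℕ} (Ω V : TopologicalSpace.Opens (Colombeau.Rd d)) (hV : V ≤ Ω)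
    (x₀ ξ₀ : Colombeau.Rd d) (hx₀ : x₀ ∈ V) (hξ₀ : ξ₀ ≠ 0)
    (f : Colombeau.GenFun Ω) (hf : Colombeau.GMicroanalytic f x₀ ξ₀)
    (T : Colombeau.Distr V)
    (hT : Colombeau.StronglyAssociated T (Colombeau.restrict hV f)) :
    Colombeau.Microanalytic T x₀ ξ₀ :=
  hf.microanalytic_of_stronglyAssociated hV hx₀ hξ₀ hT
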